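/- A continuum is a connected compact metrizable space with more than one point. Let $Y$ be a continuum, let $x\in Y$, and let $X$ be the meager composant of $x$ in $Y$, that is, the union of all nowhere dense compact connected subsets of $Y$ containing $x$ (one-point sets are allowed). Give $X$ the subspace topology. Suppose that $X$ is indecomposable, i.e. the connected space $X$ is not the union of two proper closed connected subsets of $X$. Then: (i) every proper closed connected subset of $X$ is compact; (ii) $X$ is compact or $X$ is of first category (meager) in itself, i.e. $X$ is a union of countably many nowhere dense subsets of the space $X$; (iii) for every closed subset $A$ of $X$, the set $\{\mathrm{cnt}(a,A) : a\in A\}$ of connected components of $A$, where $\mathrm{cnt}(a,A)$ is the connected component of $a$ in the subspace $A$, endowed with the quotient topology from $A$, is metrizable and zero-dimensional, where a space is called zero-dimensional if it has a basis of clopen sets. -/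

import Mathlib

open Set TopologicalSpace

/-- The meager composant of `x` in `Y`: the union of all nowhere dense subcontinua of `Y`
containing `x`. One-point subcontinua are allowed here. -/
def meagerComposant {Y : Type*} [TopologicalSpace Y] (x : Y) : Set Y :=
  ⋃₀ {K : Set Y | IsCompact K ∧ IsConnected K ∧ IsNowhereDense K ∧ x ∈ K}

/-- `X` is a meager composant of `Y` if it is the meager composant of some point of `Y`. -/
def IsMeagerComposant {Y : Type*} [TopologicalSpace Y] (X : Set Y) : Prop :=
  ∃ x : Y, X = meagerComposant x

/-- A connected space is indecomposable if it is not the union of two proper closed connected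
subsets. (Whether the empty set counts as connected makes no difference here.) -/
def IsIndecomposableSpace (X : Type*) [TopologicalSpace X] : Prop :=
  ConnectedSpace X ∧
    ¬ ∃ H K : Set X, IsClosed H ∧ IsPreconnected H ∧ H ≠ univ ∧
      IsClosed K ∧ IsPreconnected K ∧ K ≠ univ ∧ H ∪ K = univ

/-- A space is zero-dimensional if its clopen subsets form a basis of the topology. -/
def IsZeroDimensional (Z : Type*) [TopologicalSpace Z] : Prop :=
  IsTopologicalBasis {s : Set Z | IsClopen s}

/-!
A proper closed connected subset `C` of the indecomposable meager composant `X` has empty interior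
in `X`, so its closure in `Y` is a nowhere dense continuum meeting `X`; hence that closure lies in
`X` and `C` is compact. If `X` is not compact, the components of a base point in the complements of
the basic open sets are countably many such subsets, and they cover `X`.

For a proper closed `A ⊆ X`, the point is that a limit `M` of continua contained in `A` is again
nowhere dense, so that `M` lies in a single component of `A` as soon as it meets `A`. Otherwise `M`
meets two components `N₁`, `N₂` of `A`. A limit continuum with interior can be replaced by a small
limit continuum near `N₁`, another one near `N₂`, and a genuine continuum in `A` close to `M` which
joins them. Iterating this finer and finer produces decreasing neighbourhoods whose intersection
contains a nowhere dense continuum in the closure of `A` that includes `N₁` and `N₂`; it must lie in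
`A`, a contradiction. It follows that the components of `A` are compact and vary upper
semicontinuously, so the quotient map is perfect and the space of components is metrizable,
σ-compact and totally disconnected, hence zero-dimensional.
-/

open Filter Topology

/-! ### Boundary bumping -/

theorem isClosed_connectedComponentIn_of_closure_subset {X : Type*} [TopologicalSpace X]
    {F : Set X} {a : X} (h : closure (connectedComponentIn F a) ⊆ F) :
    IsClosed (connectedComponentIn F a) := by
  by_cases ha : a ∈ F
  · exact isClosed_of_closure_subset
      (isPreconnected_connectedComponentIn.closure.subset_connectedComponentIn
        (subset_closure (mem_connectedComponentIn ha)) h)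
  · simp only [connectedComponentIn_eq_empty ha, isClosed_empty]

theorem isClosed_connectedComponentIn {X : Type*} [TopologicalSpace X] {F : Set X}
    (hF : IsClosed F) (a : X) : IsClosed (connectedComponentIn F a) :=
  isClosed_connectedComponentIn_of_closure_subset
    (closure_minimal (connectedComponentIn_subset F a) hF)

section BoundaryBumping

variable {X : Type*} [TopologicalSpace X] [CompactSpace X] [T2Space X]

theorem exists_isClopen_of_connectedComponent_subset {x : X} {U : Set X} (hU : IsOpen U)
    (h : connectedComponent x ⊆ U) : ∃ Z, IsClopen Z ∧ x ∈ Z ∧ Z ⊆ U := by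
  rw [connectedComponent_eq_iInter_isClopen] at h
  have : Nonempty {s : Set X // IsClopen s ∧ x ∈ s} := ⟨⟨univ, isClopen_univ, mem_univ x⟩⟩
  obtain ⟨⟨Z, hZ, hxZ⟩, hZU⟩ := exists_subset_nhds_of_isCompact
    (V := fun s : {s : Set X // IsClopen s ∧ x ∈ s} => s.1)
    (fun ⟨s, hs, hxs⟩ ⟨t, ht, hxt⟩ =>
      ⟨⟨s ∩ t, hs.inter ht, hxs, hxt⟩, inter_subset_left, inter_subset_right⟩)
    (fun s => s.2.1.isClosed.isCompact) fun y hy => hU.mem_nhds (h hy)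
  exact ⟨Z, hZ, hxZ, hZU⟩

theorem eq_univ_of_connectedComponentIn_closure_subset [PreconnectedSpace X] {V : Set X}
    (hV : IsOpen V) {c : X} (hc : c ∈ V) (h : connectedComponentIn (closure V) c ⊆ V) :
    V = univ := by
  have : CompactSpace (closure V) := isCompact_iff_compactSpace.1 isClosed_closure.isCompact
  rw [connectedComponentIn_eq_image (subset_closure hc), image_subset_iff] at h
  obtain ⟨Z, hZ, hcZ, hZV⟩ :=
    exists_isClopen_of_connectedComponent_subset (hV.preimage continuous_subtype_val) h
  obtain ⟨O, hO, rfl⟩ := isOpen_induced_iff.1 hZ.isOpen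
  have heq : (Subtype.val '' (Subtype.val ⁻¹' O : Set (closure V)) : Set X) = O ∩ V := by
    rw [Subtype.image_preimage_coe]
    exact Subset.antisymm (fun x hx => ⟨hx.2, @hZV ⟨x, hx.1⟩ hx.2⟩)
      fun x hx => ⟨subset_closure hx.2, hx.1⟩
  have hclopen : IsClopen (O ∩ V) :=
    ⟨heq ▸ isClosed_closure.isClosedMap_subtype_val _ hZ.isClosed, hO.inter hV⟩
  rcases isClopen_iff.1 hclopen with h | h
  · exact absurd ⟨hcZ, hc⟩ (h ▸ notMem_empty c)
  · exact univ_subset_iff.1 (h ▸ inter_subset_right)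

end BoundaryBumping

section Continua

variable {Y : Type*} [TopologicalSpace Y]

theorem exists_subcontinuum_reaching_compl [T2Space Y] {K : NonemptyCompacts Y}
    (hK : IsConnected (K : Set Y)) {V : Set Y} (hV : IsOpen V) {c : Y} (hcK : c ∈ K) (hcV : c ∈ V) :
    ∃ L ≤ K, IsConnected (L : Set Y) ∧ c ∈ L ∧ (L : Set Y) ⊆ closure V ∧
      ((K : Set Y) ⊆ V ∨ ((L : Set Y) ∩ Vᶜ).Nonempty) := by
  have : ConnectedSpace K := isConnected_iff_connectedSpace.1 hK
  have : CompactSpace K := isCompact_iff_compactSpace.1 K.isCompact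
  let V' : Set K := Subtype.val ⁻¹' V
  let C : Set K := connectedComponentIn (closure V') ⟨c, hcK⟩
  have hC : IsConnected C := isConnected_connectedComponentIn_iff.2 (subset_closure hcV)
  have hCV : C ⊆ closure V' := connectedComponentIn_subset _ _
  have hCc : IsClosed C := isClosed_connectedComponentIn isClosed_closure _
  refine ⟨⟨⟨Subtype.val '' C, hCc.isCompact.image continuous_subtype_val⟩, hC.nonempty.image _⟩,
    Subtype.coe_image_subset _ _, hC.image _ continuous_subtype_val.continuousOn,
    ⟨_, mem_connectedComponentIn (subset_closure hcV), rfl⟩, ?_, ?_⟩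
  · exact image_subset_iff.2
      (hCV.trans (continuous_subtype_val.closure_preimage_subset V))
  · by_cases h : C ⊆ V'
    · refine .inl fun y hy => ?_
      exact (eq_univ_of_connectedComponentIn_closure_subset (hV.preimage continuous_subtype_val)
        hcV h).ge (mem_univ (⟨y, hy⟩ : K))
    · obtain ⟨y, hyC, hyV⟩ := not_subset.1 h
      exact .inr ⟨y, ⟨y, hyC, rfl⟩, hyV⟩

/-! ### Limits of continua -/

theorem isClosed_setOfPred_isConnected [T2Space Y] :
    IsClosed {K : NonemptyCompacts Y | IsConnected (K : Set Y)} := by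
  refine isOpen_compl_iff.1 (isOpen_iff_forall_mem_open.2 fun K hK => ?_)
  have hK' : ¬ IsPreconnected (K : Set Y) := fun h => hK ⟨K.nonempty, h⟩
  simp only [isPreconnected_iff_subset_of_fully_disjoint_closed K.isCompact.isClosed, not_forall,
    not_or, not_subset] at hK'
  obtain ⟨s, t, hs, ht, hst, hd, ⟨p, hpK, hps⟩, q, hqK, hqt⟩ := hK'
  obtain ⟨u, v, hu, hv, hsu, htv, huv⟩ := SeparatedNhds.of_isCompact_isCompact
    (K.isCompact.inter_right hs) (K.isCompact.inter_right ht)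
    (hd.mono inter_subset_right inter_subset_right)
  refine ⟨{L | (L : Set Y) ⊆ u ∪ v} ∩
      ({L | ((L : Set Y) ∩ u).Nonempty} ∩ {L | ((L : Set Y) ∩ v).Nonempty}), ?_,
    (NonemptyCompacts.isOpen_subsets_of_isOpen (hu.union hv)).inter
      ((NonemptyCompacts.isOpen_inter_nonempty_of_isOpen hu).inter
        (NonemptyCompacts.isOpen_inter_nonempty_of_isOpen hv)), ?_, ?_, ?_⟩
  · rintro L ⟨hL, hLu, hLv⟩ hLc
    obtain ⟨z, -, hz⟩ := hLc.isPreconnected u v hu hv hL hLu hLv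
    exact huv.le_bot hz
  · exact fun x hx => (hst hx).imp (fun h => hsu ⟨hx, h⟩) fun h => htv ⟨hx, h⟩
  · exact ⟨q, hqK, hsu ⟨hqK, (hst hqK).resolve_right hqt⟩⟩
  · exact ⟨p, hpK, htv ⟨hpK, (hst hpK).resolve_left hps⟩⟩

theorem isClosed_setOfPred_nonemptyCompacts_le [T2Space Y] :
    IsClosed {p : NonemptyCompacts Y × NonemptyCompacts Y | p.1 ≤ p.2} := by
  simpa only [sup_eq_right] using
    isClosed_eq (continuous_fst.sup continuous_snd) (continuous_snd (X := NonemptyCompacts Y))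

theorem isClosed_setOfPred_mem_nonemptyCompacts [T2Space Y] :
    IsClosed {p : Y × NonemptyCompacts Y | p.1 ∈ p.2} := by
  have h := isClosed_setOfPred_nonemptyCompacts_le.preimage
    ((NonemptyCompacts.continuous_singleton (α := Y)).prodMap continuous_id)
  simpa only [preimage_ofPred_eq, Prod.map_fst, Prod.map_snd, id_eq, ← SetLike.coe_subset_coe,
    NonemptyCompacts.coe_singleton, singleton_subset_iff, SetLike.mem_coe] using h

theorem isClosed_setOfPred_subset_nonemptyCompacts [T2Space Y] (S : Set Y) :
    IsClosed {K : NonemptyCompacts Y | S ⊆ K} := by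
  have h (y : Y) : IsClosed {K : NonemptyCompacts Y | y ∈ K} :=
    isClosed_setOfPred_mem_nonemptyCompacts.preimage (by fun_prop : Continuous fun K => (y, K))
  convert isClosed_biInter fun y (_ : y ∈ S) => h y
  simp only [subset_def, SetLike.mem_coe, ofPred_forall]

theorem exists_isConnected_superset_of_antitone [CompactSpace Y] [T2Space Y] {S : Set Y}
    {F : ℕ → Set Y} (hF : ∀ n, IsClosed (F n)) (hanti : ∀ n, F (n + 1) ⊆ F n)
    (h : ∀ n, ∃ K, IsClosed K ∧ IsConnected K ∧ S ⊆ K ∧ K ⊆ F n) :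
    ∃ K, IsClosed K ∧ IsConnected K ∧ S ⊆ K ∧ ∀ n, K ⊆ F n := by
  let 𝒦 (n : ℕ) : Set (NonemptyCompacts Y) :=
    {K | IsConnected (K : Set Y)} ∩ {K | S ⊆ K} ∩ {K | (K : Set Y) ⊆ F n}
  have hclosed (n : ℕ) : IsClosed (𝒦 n) :=
    (isClosed_setOfPred_isConnected.inter (isClosed_setOfPred_subset_nonemptyCompacts S)).inter
      (NonemptyCompacts.isClosed_subsets_of_isClosed (hF n))
  have hne (n : ℕ) : (𝒦 n).Nonempty := by
    obtain ⟨K, hKc, hK, hSK, hKF⟩ := h n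
    exact ⟨⟨⟨K, hKc.isCompact⟩, hK.nonempty⟩, ⟨hK, hSK⟩, hKF⟩
  obtain ⟨K, hK⟩ := IsCompact.nonempty_iInter_of_sequence_nonempty_isCompact_isClosed 𝒦
    (fun n => inter_subset_inter_right _ fun K hK => Subset.trans hK (hanti n)) hne
    (hclosed 0).isCompact hclosed
  rw [mem_iInter] at hK
  exact ⟨K, K.isCompact.isClosed, (hK 0).1.1, (hK 0).1.2, fun n => (hK n).2⟩

theorem prodMk_mem_closure_of_mem_closure {𝒦 : Set (NonemptyCompacts Y)} {M : NonemptyCompacts Y}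
    (hM : M ∈ closure 𝒦) {c : Y} (hc : c ∈ M) :
    (c, M) ∈ closure {p : Y × NonemptyCompacts Y | p.1 ∈ p.2 ∧ p.2 ∈ 𝒦} := by
  rw [mem_closure_iff_nhds_basis ((nhds_basis_opens c).prod_nhds (nhds_basis_opens M))]
  rintro ⟨O, 𝒲⟩ ⟨⟨hcO, hO⟩, hM𝒲, h𝒲⟩
  obtain ⟨K, ⟨hK𝒲, y, hyK, hyO⟩, hK⟩ := mem_closure_iff.1 hM _
    (h𝒲.inter (NonemptyCompacts.isOpen_inter_nonempty_of_isOpen hO)) ⟨hM𝒲, c, hc, hcO⟩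
  exact ⟨(y, K), ⟨hyK, hK⟩, hyO, hK𝒲⟩

/-- The continua contained in `A`, as points of the Vietoris hyperspace of nonempty compact sets.
Its closure consists of the limits of such continua. -/
def continuaIn (A : Set Y) : Set (NonemptyCompacts Y) :=
  {K | IsConnected (K : Set Y) ∧ (K : Set Y) ⊆ A}

variable {A : Set Y} {M : NonemptyCompacts Y}

theorem isConnected_of_mem_closure_continuaIn [T2Space Y] (hM : M ∈ closure (continuaIn A)) :
    IsConnected (M : Set Y) :=
  closure_minimal (fun _ hK => hK.1) isClosed_setOfPred_isConnected hM

theorem subset_closure_of_mem_closure_continuaIn (hM : M ∈ closure (continuaIn A)) :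
    (M : Set Y) ⊆ closure A :=
  closure_minimal (fun _ hK => hK.2.trans subset_closure)
    (NonemptyCompacts.isClosed_subsets_of_isClosed isClosed_closure) hM

theorem exists_limit_reaching_compl [CompactSpace Y] [T2Space Y]
    (hM : M ∈ closure (continuaIn A)) {V : Set Y} (hV : IsOpen V) {c : Y} (hcM : c ∈ M)
    (hcV : c ∈ V) :
    ∃ L ≤ M, L ∈ closure (continuaIn A) ∧ c ∈ L ∧ (L : Set Y) ⊆ closure V ∧
      ((M : Set Y) ⊆ closure V ∨ ((L : Set Y) ∩ Vᶜ).Nonempty) := by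
  let T : Set ((Y × NonemptyCompacts Y) × NonemptyCompacts Y) :=
    {p | p.1.1 ∈ p.2 ∧ p.2 ≤ p.1.2 ∧ p.2 ∈ closure (continuaIn A) ∧ (p.2 : Set Y) ⊆ closure V ∧
      ((p.1.2 : Set Y) ⊆ closure V ∨ ((p.2 : Set Y) ∩ Vᶜ).Nonempty)}
  have hsub : IsClosed {K : NonemptyCompacts Y | (K : Set Y) ⊆ closure V} :=
    NonemptyCompacts.isClosed_subsets_of_isClosed isClosed_closure
  have hT : IsClosed T :=
    (isClosed_setOfPred_mem_nonemptyCompacts.preimage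
      ((continuous_fst.comp continuous_fst).prodMk continuous_snd)).inter
      ((isClosed_setOfPred_nonemptyCompacts_le.preimage
        (continuous_snd.prodMk (continuous_snd.comp continuous_fst))).inter
      ((isClosed_closure.preimage continuous_snd).inter ((hsub.preimage continuous_snd).inter
      ((hsub.preimage (continuous_snd.comp continuous_fst)).union
        ((NonemptyCompacts.isClosed_inter_nonempty_of_isClosed hV.isClosed_compl).preimage
          continuous_snd)))))
  have hcont : Prod.fst ⁻¹' V ∩ {p : Y × NonemptyCompacts Y | p.1 ∈ p.2 ∧ p.2 ∈ continuaIn A} ⊆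
      Prod.fst '' T := by
    rintro ⟨c', K⟩ ⟨hcV', hcK, hK⟩
    obtain ⟨L, hLK, hL, hcL, hLV, hreach⟩ := exists_subcontinuum_reaching_compl hK.1 hV hcK hcV'
    exact ⟨((c', K), L), ⟨hcL, hLK, subset_closure ⟨hL, Subset.trans hLK hK.2⟩, hLV,
      hreach.imp_left fun h => h.trans subset_closure⟩, rfl⟩
  have hlim := (hV.preimage continuous_fst).inter_closure
    ⟨hcV, prodMk_mem_closure_of_mem_closure hM hcM⟩
  obtain ⟨⟨_, L⟩, ⟨hcL, hLM, hL⟩, rfl⟩ :=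
    closure_minimal hcont (isClosedMap_fst_of_compactSpace T hT) hlim
  exact ⟨L, hLM, hL.1, hcL, hL.2⟩

end Continua

/-! ### Thin sets -/

theorem isNowhereDense_union {Y : Type*} [TopologicalSpace Y] {s t : Set Y}
    (hs : IsNowhereDense s) (ht : IsNowhereDense t) : IsNowhereDense (s ∪ t) := by
  rw [IsNowhereDense, closure_union,
    interior_union_isClosed_of_interior_empty isClosed_closure ht, hs]

theorem not_subset_of_isNowhereDense {Y : Type*} [TopologicalSpace Y] {s O : Set Y}
    (hs : IsNowhereDense s) (hO : IsOpen O) (hne : O.Nonempty) : ¬ O ⊆ s := fun h =>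
  hne.ne_empty <| subset_empty_iff.1 <| hs ▸ interior_maximal (h.trans subset_closure) hO

theorem exists_seq_isTopologicalBasis (Y : Type*) [TopologicalSpace Y] [SecondCountableTopology Y]
    [Nonempty Y] : ∃ B : ℕ → Set Y, (∀ n, (B n).Nonempty) ∧ IsTopologicalBasis (range B) := by
  obtain ⟨s, hs, -⟩ := (isBasis_countableBasis Y).exists_subset_of_mem_open
    (mem_univ (Classical.arbitrary Y)) isOpen_univ
  obtain ⟨B, hB⟩ := (countable_countableBasis Y).exists_eq_range ⟨s, hs⟩
  exact ⟨B, fun n => nonempty_of_mem_countableBasis (hB ▸ mem_range_self n),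
    hB ▸ isBasis_countableBasis Y⟩

/-- `A` has nowhere dense connected subsets only, and swallows every nowhere dense continuum in its
closure that it meets. This is what is left of a proper closed subset of an indecomposable meager
composant once that composant is forgotten. -/
structure IsThin {Y : Type*} [TopologicalSpace Y] (A : Set Y) : Prop where
  isNowhereDense : ∀ S ⊆ A, IsPreconnected S → IsNowhereDense S
  subset : ∀ P, IsCompact P → IsConnected P → IsNowhereDense P → P ⊆ closure A →
    (P ∩ A).Nonempty → P ⊆ A

/-- `N` is a continuum in `A` that meets `M` and absorbs the connected subsets of `A ∩ M` it
meets. -/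
structure IsAnchor {Y : Type*} [TopologicalSpace Y] (A M N : Set Y) : Prop where
  isClosed : IsClosed N
  isPreconnected : IsPreconnected N
  subset : N ⊆ A
  inter_nonempty : (M ∩ N).Nonempty
  absorbs : ∀ P ⊆ A ∩ M, IsPreconnected P → (P ∩ N).Nonempty → P ⊆ N

/-- `IsBridgedChain A S P`: the set `P` is a union of `S` and finitely many limits of continua
contained in `A`, where `S` is a finite union of continua in `A`, any two of them joined by a chain
in which consecutive ones are anchors of a common limit. -/
inductive IsBridgedChain {Y : Type*} [TopologicalSpace Y] (A : Set Y) : Set Y → Set Y → Prop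
  | bridge {M : NonemptyCompacts Y} {N N' : Set Y} : M ∈ closure (continuaIn A) →
      IsAnchor A M N → IsAnchor A M N' → IsBridgedChain A (N ∪ N') (N ∪ N' ∪ M)
  | union {S S' P P' : Set Y} : IsBridgedChain A S P → IsBridgedChain A S' P' →
      (S ∩ S').Nonempty → IsBridgedChain A (S ∪ S') (P ∪ P')

section Chain

variable {Y : Type*} [TopologicalSpace Y] {A S P M N : Set Y}

theorem IsAnchor.mono {M' : Set Y} (h : IsAnchor A M N) (hM' : M' ⊆ M)
    (hne : (M' ∩ N).Nonempty) : IsAnchor A M' N where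
  __ := h
  inter_nonempty := hne
  absorbs := fun P hP => h.absorbs P (hP.trans (inter_subset_inter_right A hM'))

namespace IsBridgedChain

theorem skeleton_subset (h : IsBridgedChain A S P) : S ⊆ P := by
  induction h with
  | bridge => exact subset_union_left
  | union _ _ _ ih ih' => exact union_subset_union ih ih'

theorem isClosed_skeleton (h : IsBridgedChain A S P) : IsClosed S := by
  induction h with
  | bridge _ hN hN' => exact hN.isClosed.union hN'.isClosed
  | union _ _ _ ih ih' => exact ih.union ih'

theorem isNowhereDense_skeleton (hA : IsThin A) (h : IsBridgedChain A S P) :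
    IsNowhereDense S := by
  induction h with
  | bridge _ hN hN' =>
    exact isNowhereDense_union (hA.isNowhereDense _ hN.subset hN.isPreconnected)
      (hA.isNowhereDense _ hN'.subset hN'.isPreconnected)
  | union _ _ _ ih ih' => exact isNowhereDense_union ih ih'

theorem subset_closure (h : IsBridgedChain A S P) : P ⊆ closure A := by
  induction h with
  | bridge hM hN hN' =>
    exact union_subset ((union_subset hN.subset hN'.subset).trans _root_.subset_closure)
      (subset_closure_of_mem_closure_continuaIn hM)
  | union _ _ _ ih ih' => exact union_subset ih ih'

theorem isClosed [T2Space Y] (h : IsBridgedChain A S P) : IsClosed P := by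
  induction h with
  | @bridge M _ _ _ hN hN' => exact (hN.isClosed.union hN'.isClosed).union M.isCompact.isClosed
  | union _ _ _ ih ih' => exact ih.union ih'

theorem isConnected [T2Space Y] (h : IsBridgedChain A S P) : IsConnected P := by
  induction h with
  | @bridge M N N' hM hN hN' =>
    rw [union_union_distrib_right]
    have hMc := isConnected_of_mem_closure_continuaIn hM
    have hNM {N : Set Y} (hN : IsAnchor A M N) : IsConnected (N ∪ M) :=
      .union (inter_comm N M ▸ hN.inter_nonempty) ⟨hN.inter_nonempty.right, hN.isPreconnected⟩ hMc
    exact .union (hMc.nonempty.mono (subset_inter subset_union_right subset_union_right))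
      (hNM hN) (hNM hN')
  | union h h' hne ih ih' =>
    exact ih.union (hne.mono (inter_subset_inter h.skeleton_subset h'.skeleton_subset)) ih'

end IsBridgedChain

end Chain

section Thin

variable {Y : Type*} [TopologicalSpace Y] {A S P M N U W E : Set Y}

namespace IsThin

theorem closure_subset [CompactSpace Y] (hA : IsThin A) (hSA : S ⊆ A) (hS : IsPreconnected S) :
    closure S ⊆ A := by
  rcases S.eq_empty_or_nonempty with rfl | hne
  · simp only [closure_empty, empty_subset]
  · exact hA.subset _ isClosed_closure.isCompact ⟨hne.closure, hS.closure⟩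
      (hA.isNowhereDense S hSA hS).closure (closure_mono hSA)
      (hne.mono (subset_inter subset_closure hSA))

theorem isClosed_connectedComponentIn_inter [CompactSpace Y] (hA : IsThin A) (hE : IsClosed E)
    (a : Y) : IsClosed (connectedComponentIn (A ∩ E) a) := by
  have hsub := connectedComponentIn_subset (A ∩ E) a
  exact isClosed_connectedComponentIn_of_closure_subset <| subset_inter
    (hA.closure_subset (hsub.trans inter_subset_left) isPreconnected_connectedComponentIn)
    (closure_minimal (hsub.trans inter_subset_right) hE)

theorem isClosed_connectedComponentIn [CompactSpace Y] (hA : IsThin A) (a : Y) :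
    IsClosed (connectedComponentIn A a) := by
  simpa only [inter_univ] using hA.isClosed_connectedComponentIn_inter isClosed_univ a

theorem isAnchor_connectedComponentIn [CompactSpace Y] (hA : IsThin A) (hE : IsClosed E)
    (hME : M ⊆ E) {a : Y} (hne : (M ∩ connectedComponentIn (A ∩ E) a).Nonempty) :
    IsAnchor A M (connectedComponentIn (A ∩ E) a) where
  isClosed := hA.isClosed_connectedComponentIn_inter hE a
  isPreconnected := isPreconnected_connectedComponentIn
  subset := (connectedComponentIn_subset _ _).trans inter_subset_left
  inter_nonempty := hne
  absorbs := by
    rintro P hP hPc ⟨y, hyP, hy⟩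
    rw [connectedComponentIn_eq hy]
    exact hPc.subset_connectedComponentIn hyP (hP.trans (inter_subset_inter_right A hME))

end IsThin

theorem IsAnchor.absorbs_limit [T2Space Y] (hA : IsThin A) (hN : IsAnchor A M N)
    {L : NonemptyCompacts Y} (hL : L ∈ closure (continuaIn A)) (hLM : (L : Set Y) ⊆ M)
    (hnd : IsNowhereDense (L : Set Y)) (hne : ((L : Set Y) ∩ N).Nonempty) : (L : Set Y) ⊆ N := by
  have hLc := isConnected_of_mem_closure_continuaIn hL
  have hLA : (L : Set Y) ⊆ A := hA.subset L L.isCompact hLc hnd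
    (subset_closure_of_mem_closure_continuaIn hL) (hne.mono (inter_subset_inter_right _ hN.subset))
  exact hN.absorbs L (subset_inter hLA hLM) hLc.isPreconnected hne

variable [CompactSpace Y] [T2Space Y]

theorem IsAnchor.exists_limit_near (hA : IsThin A) {M : NonemptyCompacts Y}
    (hM : M ∈ closure (continuaIn A)) (hN : IsAnchor A M N) (hint : (interior (M : Set Y)).Nonempty)
    (hW : IsOpen W) (hNW : N ⊆ W) :
    ∃ L ≤ M, L ∈ closure (continuaIn A) ∧ IsAnchor A L N ∧ (L : Set Y) ⊆ closure W ∧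
      (interior (L : Set Y)).Nonempty := by
  obtain ⟨c, hcM, hcN⟩ := hN.inter_nonempty
  obtain ⟨L, hLM, hL, hcL, hLW, h⟩ := exists_limit_reaching_compl hM hW hcM (hNW hcN)
  rcases h with hMW | ⟨y, hyL, hyW⟩
  · exact ⟨M, le_rfl, hM, hN, hMW, hint⟩
  · refine ⟨L, hLM, hL, hN.mono hLM ⟨c, hcL, hcN⟩, hLW, nonempty_iff_ne_empty.2 fun hempty => ?_⟩
    have hnd : IsNowhereDense (L : Set Y) := L.isCompact.isClosed.isNowhereDense_iff.2 hempty
    exact hyW (hNW (hN.absorbs_limit hA hL hLM hnd ⟨c, hcL, hcN⟩ hyL))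

theorem exists_refined_bridge (hA : IsThin A) {M : NonemptyCompacts Y} {N' : Set Y}
    (hM : M ∈ closure (continuaIn A)) (hN : IsAnchor A M N) (hN' : IsAnchor A M N')
    (hint : (interior (M : Set Y)).Nonempty) (hU : IsOpen U) (hPU : N ∪ N' ∪ M ⊆ U)
    (hW : IsOpen W) (hSW : N ∪ N' ⊆ W) :
    ∃ S P, IsBridgedChain A S P ∧ N ∪ N' ⊆ S ∧ P ⊆ closure U ∧ P ⊆ closure W ∪ S := by
  have hMU : (M : Set Y) ⊆ U := subset_union_right.trans hPU
  have hSU : N ∪ N' ⊆ U := subset_union_left.trans hPU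
  obtain ⟨L, hLM, hL, hNL, hLW, hLint⟩ :=
    hN.exists_limit_near hA hM hint hW (subset_union_left.trans hSW)
  obtain ⟨L', hLM', hL', hNL', hLW', hLint'⟩ :=
    hN'.exists_limit_near hA hM hint hW (subset_union_right.trans hSW)
  -- A continuum in `A` close enough to `M` stays in `U` and meets the interiors of both limits.
  obtain ⟨K, ⟨hKU, ⟨x, hxK, hxL⟩, ⟨x', hxK', hxL'⟩⟩, hKc, hKA⟩ := mem_closure_iff.1 hM _
    ((NonemptyCompacts.isOpen_subsets_of_isOpen hU).inter
      ((NonemptyCompacts.isOpen_inter_nonempty_of_isOpen isOpen_interior).inter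
        (NonemptyCompacts.isOpen_inter_nonempty_of_isOpen isOpen_interior)))
    ⟨hMU, hLint.mono (subset_inter (interior_subset.trans hLM) Subset.rfl),
      hLint'.mono (subset_inter (interior_subset.trans hLM') Subset.rfl)⟩
  let C := connectedComponentIn (A ∩ closure U) x
  have hKC : (K : Set Y) ⊆ C := hKc.isPreconnected.subset_connectedComponentIn hxK
    (subset_inter hKA (hKU.trans subset_closure))
  have hCU : C ⊆ closure U := (connectedComponentIn_subset _ _).trans inter_subset_right
  have hMU' : (M : Set Y) ⊆ closure U := hMU.trans subset_closure
  have hCL : IsAnchor A L C := hA.isAnchor_connectedComponentIn isClosed_closure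
    (Subset.trans hLM hMU') ⟨x, interior_subset hxL, hKC hxK⟩
  have hCL' : IsAnchor A L' C := hA.isAnchor_connectedComponentIn isClosed_closure
    (Subset.trans hLM' hMU') ⟨x', interior_subset hxL', hKC hxK'⟩
  refine ⟨_, _, .union (.bridge hL hNL hCL) (.bridge hL' hCL' hNL')
    ⟨x, .inr (hKC hxK), .inl (hKC hxK)⟩,
    union_subset_union subset_union_left subset_union_right, ?_, ?_⟩
  · have hNU := union_subset_iff.1 (hSU.trans subset_closure)
    exact union_subset
      (union_subset (union_subset hNU.1 hCU) (Subset.trans hLM hMU'))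
      (union_subset (union_subset hCU hNU.2) (Subset.trans hLM' hMU'))
  · exact union_subset
      (union_subset (subset_union_left.trans subset_union_right) (hLW.trans subset_union_left))
      (union_subset (subset_union_right.trans subset_union_right) (hLW'.trans subset_union_left))

theorem IsBridgedChain.exists_refinement (hA : IsThin A) (h : IsBridgedChain A S P)
    (hU : IsOpen U) (hPU : P ⊆ U) (hW : IsOpen W) (hSW : S ⊆ W) :
    ∃ S' P', IsBridgedChain A S' P' ∧ S ⊆ S' ∧ P' ⊆ closure U ∧ P' ⊆ closure W ∪ S' := by
  induction h with
  | @bridge M N N' hM hN hN' =>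
    by_cases hint : (interior (M : Set Y)).Nonempty
    · exact exists_refined_bridge hA hM hN hN' hint hU hPU hW hSW
    · have hMN : (M : Set Y) ⊆ N := hN.absorbs_limit hA hM Subset.rfl
        (M.isCompact.isClosed.isNowhereDense_iff.2 (not_nonempty_iff_eq_empty.1 hint))
        hN.inter_nonempty
      exact ⟨_, _, .bridge hM hN hN', Subset.rfl, hPU.trans _root_.subset_closure,
        union_subset subset_union_right (hMN.trans (subset_union_left.trans subset_union_right))⟩
  | @union S₁ S₂ P₁ P₂ _ _ hne ih ih' =>
    obtain ⟨T₁, Q₁, h₁, hST₁, hQU₁, hQW₁⟩ :=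
      ih (subset_union_left.trans hPU) (subset_union_left.trans hSW)
    obtain ⟨T₂, Q₂, h₂, hST₂, hQU₂, hQW₂⟩ :=
      ih' (subset_union_right.trans hPU) (subset_union_right.trans hSW)
    refine ⟨_, _, .union h₁ h₂ (hne.mono (inter_subset_inter hST₁ hST₂)),
      union_subset_union hST₁ hST₂, union_subset hQU₁ hQU₂, union_subset ?_ ?_⟩
    · exact hQW₁.trans (union_subset_union_right _ subset_union_left)
    · exact hQW₂.trans (union_subset_union_right _ subset_union_right)

theorem IsBridgedChain.exists_thinner (hA : IsThin A) (h : IsBridgedChain A S P) (hU : IsOpen U)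
    (hPU : P ⊆ U) {O : Set Y} (hO : IsOpen O) (hOne : O.Nonempty) :
    ∃ S' P' U', IsBridgedChain A S' P' ∧ S ⊆ S' ∧ IsOpen U' ∧ P' ⊆ U' ∧ closure U' ⊆ U ∧
      ¬ O ⊆ U' := by
  obtain ⟨x, hxO, hxS⟩ :=
    not_subset.1 (not_subset_of_isNowhereDense (h.isNowhereDense_skeleton hA) hO hOne)
  obtain ⟨W, hW, hSW, hxW⟩ := normal_exists_closure_subset h.isClosed_skeleton
    (isOpen_compl_singleton (x := x)) (subset_compl_singleton_iff.2 hxS)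
  obtain ⟨V, hV, hPV, hVU⟩ := normal_exists_closure_subset h.isClosed hU hPU
  obtain ⟨S', P', h', hSS', hPV', hPW'⟩ := h.exists_refinement hA hV hPV hW hSW
  -- The refined chain leaves `closure W` only inside a nowhere dense set, so it cannot fill `O`.
  obtain ⟨y, ⟨hyO, hyW⟩, hyS⟩ :=
    not_subset.1 (not_subset_of_isNowhereDense (h'.isNowhereDense_skeleton hA)
      (hO.sdiff isClosed_closure) ⟨x, hxO, fun hx => hxW hx rfl⟩)
  have hyP : P' ⊆ U ∩ {y}ᶜ := subset_inter (hPV'.trans hVU)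
    (subset_compl_singleton_iff.2 fun hy => (hPW' hy).elim hyW hyS)
  obtain ⟨U', hU', hPU', hUU'⟩ :=
    normal_exists_closure_subset h'.isClosed (hU.inter isOpen_compl_singleton) hyP
  exact ⟨S', P', U', h', hSS', hU', hPU', hUU'.trans inter_subset_left,
    fun hOU => (hUU' (_root_.subset_closure (hOU hyO))).2 rfl⟩

theorem IsBridgedChain.exists_seq_isOpen (hA : IsThin A) (h : IsBridgedChain A S P)
    {B : ℕ → Set Y} (hB : ∀ n, IsOpen (B n)) (hBne : ∀ n, (B n).Nonempty) :
    ∃ U : ℕ → Set Y, (∀ n, closure (U (n + 1)) ⊆ U n) ∧ (∀ n, ¬ B n ⊆ U (n + 1)) ∧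
      ∀ n, ∃ S' P', IsBridgedChain A S' P' ∧ S ⊆ S' ∧ P' ⊆ U n := by
  let 𝒰 := {U : Set Y // IsOpen U ∧ ∃ S' P', IsBridgedChain A S' P' ∧ S ⊆ S' ∧ P' ⊆ U}
  have hstep (n : ℕ) (U : 𝒰) : ∃ U' : 𝒰, closure U'.1 ⊆ U.1 ∧ ¬ B n ⊆ U'.1 := by
    obtain ⟨U, hU, S', P', h', hSS', hPU'⟩ := U
    obtain ⟨S'', P'', U', h'', hSS'', hU', hPU'', hUU', hBU'⟩ :=
      h'.exists_thinner hA hU hPU' (hB n) (hBne n)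
    exact ⟨⟨U', hU', S'', P'', h'', hSS'.trans hSS'', hPU''⟩, hUU', hBU'⟩
  choose next hclosure hnot using hstep
  let U (n : ℕ) : 𝒰 := n.rec ⟨univ, isOpen_univ, S, P, h, Subset.rfl, subset_univ P⟩ next
  exact ⟨fun n => (U n).1, fun n => hclosure n (U n), fun n => hnot n (U n), fun n => (U n).2.2⟩

theorem IsBridgedChain.exists_isConnected_superset [SecondCountableTopology Y] (hA : IsThin A)
    (h : IsBridgedChain A S P) (hS : (S ∩ A).Nonempty) : ∃ K ⊆ A, IsConnected K ∧ S ⊆ K := by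
  have : Nonempty Y := ⟨hS.some⟩
  obtain ⟨B, hBne, hB⟩ := exists_seq_isTopologicalBasis Y
  obtain ⟨U, hUU, hBU, hU⟩ := h.exists_seq_isOpen hA (fun n => hB.isOpen (mem_range_self n)) hBne
  obtain ⟨K, hKc, hK, hSK, hKU⟩ := exists_isConnected_superset_of_antitone
    (S := S) (F := fun n => closure (U n) ∩ closure A)
    (fun n => isClosed_closure.inter isClosed_closure)
    (fun n => inter_subset_inter_left _ ((hUU n).trans _root_.subset_closure)) fun n => by
      obtain ⟨S', P', h', hSS', hPU'⟩ := hU n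
      exact ⟨P', h'.isClosed, h'.isConnected, hSS'.trans h'.skeleton_subset,
        subset_inter (hPU'.trans _root_.subset_closure) h'.subset_closure⟩
  have hnd : IsNowhereDense K := by
    rw [hKc.isNowhereDense_iff, ← not_nonempty_iff_eq_empty]
    rintro ⟨x, hx⟩
    obtain ⟨_, ⟨n, rfl⟩, -, hBK⟩ := hB.exists_subset_of_mem_open hx isOpen_interior
    exact hBU n ((hBK.trans interior_subset).trans
      ((hKU (n + 2)).trans (inter_subset_left.trans (hUU (n + 1)))))
  exact ⟨K, hA.subset K hKc.isCompact hK hnd ((hKU 0).trans inter_subset_right)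
    (hS.mono (inter_subset_inter_left A hSK)), hK, hSK⟩

namespace IsThin

variable {M : NonemptyCompacts Y}

theorem connectedComponentIn_eq [SecondCountableTopology Y] (hA : IsThin A)
    (hM : M ∈ closure (continuaIn A)) {a b : Y} (ha : a ∈ A) (haM : a ∈ M) (hb : b ∈ A)
    (hbM : b ∈ M) : connectedComponentIn A a = connectedComponentIn A b := by
  have hanchor {c : Y} (hc : c ∈ A) (hcM : c ∈ M) : IsAnchor A M (connectedComponentIn A c) := by
    have hne : ((M : Set Y) ∩ connectedComponentIn A c).Nonempty :=
      ⟨c, hcM, mem_connectedComponentIn hc⟩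
    rw [← inter_univ A] at hne
    simpa only [inter_univ] using
      hA.isAnchor_connectedComponentIn isClosed_univ (subset_univ _) hne
  obtain ⟨K, hKA, hK, hSK⟩ := (IsBridgedChain.bridge hM (hanchor ha haM)
    (hanchor hb hbM)).exists_isConnected_superset hA ⟨a, .inl (mem_connectedComponentIn ha), ha⟩
  exact _root_.connectedComponentIn_eq (hK.isPreconnected.subset_connectedComponentIn
    (hSK (.inl (mem_connectedComponentIn ha))) hKA (hSK (.inr (mem_connectedComponentIn hb))))

theorem isNowhereDense_of_mem_closure [SecondCountableTopology Y] (hA : IsThin A)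
    (hM : M ∈ closure (continuaIn A)) : IsNowhereDense (M : Set Y) := by
  have hmeet {O : Set Y} (hO : IsOpen O) (hOM : O ⊆ M) (hne : O.Nonempty) : (O ∩ A).Nonempty := by
    obtain ⟨x, hx⟩ := hne
    obtain ⟨K, ⟨y, hyK, hyO⟩, hK⟩ := mem_closure_iff.1 hM _
      (NonemptyCompacts.isOpen_inter_nonempty_of_isOpen hO) ⟨x, hOM hx, hx⟩
    exact ⟨y, hyO, hK.2 hyK⟩
  rw [M.isCompact.isClosed.isNowhereDense_iff, ← not_nonempty_iff_eq_empty]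
  intro hne
  obtain ⟨a, haM, ha⟩ := hmeet isOpen_interior interior_subset hne
  have hC := hA.isClosed_connectedComponentIn a
  have hnd := hA.isNowhereDense _ (connectedComponentIn_subset A a)
    isPreconnected_connectedComponentIn
  obtain ⟨x, hxM, hxC⟩ := not_subset.1 (not_subset_of_isNowhereDense hnd isOpen_interior hne)
  obtain ⟨b, ⟨hbM, hbC⟩, hb⟩ := hmeet (isOpen_interior.sdiff hC)
    (sdiff_subset.trans interior_subset) ⟨x, hxM, hxC⟩
  rw [hA.connectedComponentIn_eq hM ha (interior_subset haM) hb (interior_subset hbM)] at hbC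
  exact hbC (mem_connectedComponentIn hb)

theorem eventually_connectedComponentIn_subset [SecondCountableTopology Y] (hA : IsThin A)
    {a : Y} (ha : a ∈ A) (hU : IsOpen U) (haU : connectedComponentIn A a ⊆ U) :
    ∀ᶠ b in 𝓝[A] a, connectedComponentIn A b ⊆ U := by
  let T : Set (Y × NonemptyCompacts Y) :=
    {p | p.1 ∈ p.2 ∧ p.2 ∈ closure (continuaIn A) ∧ ((p.2 : Set Y) ∩ Uᶜ).Nonempty}
  have hT : IsClosed T := isClosed_setOfPred_mem_nonemptyCompacts.inter
    ((isClosed_closure.preimage continuous_snd).inter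
      ((NonemptyCompacts.isClosed_inter_nonempty_of_isClosed hU.isClosed_compl).preimage
        continuous_snd))
  have haT : a ∉ Prod.fst '' T := by
    rintro ⟨⟨_, M⟩, ⟨haM, hM, y, hyM, hyU⟩, rfl⟩
    have hMc := isConnected_of_mem_closure_continuaIn hM
    have hMA := hA.subset M M.isCompact hMc (hA.isNowhereDense_of_mem_closure hM)
      (subset_closure_of_mem_closure_continuaIn hM) ⟨_, haM, ha⟩
    exact hyU (haU (hMc.isPreconnected.subset_connectedComponentIn haM hMA hyM))
  filter_upwards [mem_nhdsWithin_of_mem_nhds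
    ((isClosedMap_fst_of_compactSpace T hT).isOpen_compl.mem_nhds haT), self_mem_nhdsWithin]
    with b hbT hb
  by_contra hbU
  obtain ⟨y, hy, hyU⟩ := not_subset.1 hbU
  refine hbT ⟨(b, ⟨⟨_, (hA.isClosed_connectedComponentIn b).isCompact⟩, ⟨y, hy⟩⟩),
    ⟨mem_connectedComponentIn hb, _root_.subset_closure ⟨?_, connectedComponentIn_subset A b⟩,
      y, hy, hyU⟩, rfl⟩
  exact isConnected_connectedComponentIn_iff.2 hb

end IsThin

end Thin

/-! ### Zero-dimensionality of σ-compact spaces -/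

section ZeroDimensional

variable {Q : Type*} [TopologicalSpace Q] [T4Space Q]

theorem exists_isOpen_disjoint_closure {E D : Set Q} (hE : IsClosed E) (hD : IsClosed D)
    (h : Disjoint E D) :
    ∃ u v, IsOpen u ∧ IsOpen v ∧ E ⊆ u ∧ D ⊆ v ∧ Disjoint (closure u) (closure v) := by
  obtain ⟨u, hu, hEu, huD⟩ :=
    normal_exists_closure_subset hE hD.isOpen_compl (disjoint_left.1 h)
  obtain ⟨v, hv, hDv, hvu⟩ :=
    normal_exists_closure_subset hD isClosed_closure.isOpen_compl (subset_compl_comm.1 huD)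
  exact ⟨u, v, hu, hv, hEu, hDv, disjoint_right.2 hvu⟩

variable [TotallyDisconnectedSpace Q]

theorem exists_isOpen_cover_disjoint_closure {Z E D : Set Q} (hZ : IsCompact Z)
    (hE : IsClosed E) (hD : IsClosed D) (h : Disjoint E D) :
    ∃ u v, IsOpen u ∧ IsOpen v ∧ E ⊆ u ∧ D ⊆ v ∧ Z ⊆ u ∪ v ∧
      Disjoint (closure u) (closure v) := by
  have : CompactSpace Z := isCompact_iff_compactSpace.1 hZ
  obtain ⟨C, hC, hEC, hCD⟩ := exists_clopen_of_closed_subset_open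
    (hE.preimage continuous_subtype_val) (hD.isOpen_compl.preimage continuous_subtype_val)
    (fun (z : Z) hz => disjoint_left.1 h hz)
  have himage {F : Set Z} (hF : IsClosed F) : IsClosed (Subtype.val '' F : Set Q) :=
    hZ.isClosed.isClosedMap_subtype_val F hF
  have hdisj : Disjoint (E ∪ Subtype.val '' C) (D ∪ Subtype.val '' Cᶜ) := by
    simp only [disjoint_union_left, disjoint_union_right, disjoint_image_iff Subtype.val_injective,
      disjoint_compl_right, and_true]
    refine ⟨⟨h, disjoint_left.2 ?_⟩, disjoint_right.2 ?_⟩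
    · rintro _ ⟨z, hzC, rfl⟩
      exact hCD hzC
    · rintro _ ⟨z, hzC, rfl⟩ hzE
      exact hzC (hEC hzE)
  obtain ⟨u, v, hu, hv, hEu, hDv, huv⟩ := exists_isOpen_disjoint_closure
    (hE.union (himage hC.isClosed)) (hD.union (himage hC.compl.isClosed)) hdisj
  refine ⟨u, v, hu, hv, (union_subset_iff.1 hEu).1, (union_subset_iff.1 hDv).1, fun z hz => ?_, huv⟩
  by_cases hzC : ⟨z, hz⟩ ∈ C
  · exact .inl (hEu (.inr ⟨_, hzC, rfl⟩))
  · exact .inr (hDv (.inr ⟨_, hzC, rfl⟩))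

theorem exists_isClopen_superset_of_sigmaCompact [SigmaCompactSpace Q] {E D : Set Q}
    (hE : IsClosed E) (hD : IsClosed D) (h : Disjoint E D) :
    ∃ C, IsClopen C ∧ E ⊆ C ∧ Disjoint C D := by
  let 𝒬 := {p : Set Q × Set Q // IsOpen p.1 ∧ IsOpen p.2 ∧ Disjoint (closure p.1) (closure p.2)}
  obtain ⟨u₀, v₀, hu₀, hv₀, hEu, hDv, huv₀⟩ := exists_isOpen_disjoint_closure hE hD h
  have hstep (n : ℕ) (p : 𝒬) :
      ∃ q : 𝒬, p.1 ≤ q.1 ∧ compactCovering Q n ⊆ q.1.1 ∪ q.1.2 := by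
    obtain ⟨⟨u, v⟩, hu, hv, huv⟩ := p
    obtain ⟨u', v', hu', hv', huu', hvv', hcov, huv'⟩ :=
      exists_isOpen_cover_disjoint_closure (isCompact_compactCovering Q n)
        isClosed_closure isClosed_closure huv
    exact ⟨⟨(u', v'), hu', hv', huv'⟩,
      ⟨subset_closure.trans huu', subset_closure.trans hvv'⟩, hcov⟩
  choose next hle hcov using hstep
  let p (n : ℕ) : 𝒬 := n.rec ⟨(u₀, v₀), hu₀, hv₀, huv₀⟩ next
  have hmono : Monotone fun n => (p n).1 := monotone_nat_of_le_succ fun n => hle n (p n)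
  have hUV : ⋃ n, (p n).1.2 = (⋃ n, (p n).1.1)ᶜ := by
    refine (IsCompl.compl_eq ⟨?_, codisjoint_iff_le_sup.2 fun x _ => ?_⟩).symm
    · simp only [disjoint_iUnion_left, disjoint_iUnion_right]
      intro m n
      exact (p (max n m)).2.2.2.mono
        ((hmono (le_max_left n m)).1.trans subset_closure)
        ((hmono (le_max_right n m)).2.trans subset_closure)
    · obtain ⟨n, hn⟩ := mem_iUnion.1 ((iUnion_compactCovering Q).ge (mem_univ x))
      exact (hcov n (p n) hn).imp (fun h => mem_iUnion.2 ⟨n + 1, h⟩)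
        fun h => mem_iUnion.2 ⟨n + 1, h⟩
  refine ⟨⋃ n, (p n).1.1, ⟨?_, isOpen_iUnion fun n => (p n).2.1⟩,
    hEu.trans (subset_iUnion_of_subset 0 Subset.rfl), ?_⟩
  · exact isOpen_compl_iff.1 (hUV ▸ isOpen_iUnion fun n => (p n).2.2.1)
  · rw [disjoint_right]
    exact hDv.trans ((subset_iUnion_of_subset 0 Subset.rfl).trans hUV.subset)

theorem isZeroDimensional_of_sigmaCompact [SigmaCompactSpace Q] : IsZeroDimensional Q := by
  refine isTopologicalBasis_of_isOpen_of_nhds (fun s hs => hs.isOpen) fun x U hxU hU => ?_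
  obtain ⟨C, hC, hxC, hCU⟩ := exists_isClopen_superset_of_sigmaCompact
    (isClosed_singleton (x := x)) hU.isClosed_compl (disjoint_singleton_left.2 fun h => h hxU)
  exact ⟨C, hC, singleton_subset_iff.1 hxC, disjoint_compl_right_iff_subset.1 hCU⟩

end ZeroDimensional

/-! ### The space of components -/

section ClosedMap

variable {Z Q : Type*} [TopologicalSpace Z] [TopologicalSpace Q] {f : Z → Q}

theorem t4Space_of_isClosedMap [T4Space Z] (hf : Continuous f) (hfc : IsClosedMap f)
    (hfs : Function.Surjective f) : T4Space Q where
  t1 q := by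
    obtain ⟨z, rfl⟩ := hfs q
    exact image_singleton ▸ hfc _ isClosed_singleton
  normal s t hs ht hst := by
    obtain ⟨u, v, hu, hv, hsu, htv, huv⟩ :=
      normal_separation (hs.preimage hf) (ht.preimage hf) (hst.preimage f)
    refine ⟨kernImage f u, kernImage f v, isClosedMap_iff_kernImage.1 hfc hu,
      isClosedMap_iff_kernImage.1 hfc hv, subset_kernImage_iff.2 hsu, subset_kernImage_iff.2 htv,
      disjoint_left.2 fun q hqu hqv => ?_⟩
    obtain ⟨z, rfl⟩ := hfs q
    exact disjoint_left.1 huv (hqu rfl) (hqv rfl)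

theorem secondCountableTopology_of_isClosedMap [SecondCountableTopology Z] (hf : Continuous f)
    (hfc : IsClosedMap f) (hfs : Function.Surjective f) (hK : ∀ q, IsCompact (f ⁻¹' {q})) :
    SecondCountableTopology Q := by
  let B := countableBasis Z
  have hB {t : Set (Set Z)} (ht : t ⊆ B) : IsOpen (⋃₀ t) :=
    isOpen_sUnion fun s hs => isOpen_of_mem_countableBasis (ht hs)
  have hbasis : IsTopologicalBasis
      ((fun t : Set (Set Z) => kernImage f (⋃₀ t)) '' {t | t.Finite ∧ t ⊆ B}) := by
    refine isTopologicalBasis_of_isOpen_of_nhds ?_ fun q W hq hW => ?_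
    · rintro _ ⟨t, ⟨-, ht⟩, rfl⟩
      exact isClosedMap_iff_kernImage.1 hfc (hB ht)
    · obtain ⟨S, hSB, hS⟩ := (isBasis_countableBasis Z).open_eq_sUnion (hW.preimage hf)
      have hqS : f ⁻¹' {q} ⊆ ⋃₀ S := hS ▸ preimage_mono (singleton_subset_iff.2 hq)
      obtain ⟨t, htS, ht, hqt⟩ := (hK q).elim_finite_subcover_image
        (fun s hs => isOpen_of_mem_countableBasis (hSB hs)) (sUnion_eq_biUnion ▸ hqS)
      rw [← sUnion_eq_biUnion] at hqt
      refine ⟨_, ⟨t, ⟨ht, htS.trans hSB⟩, rfl⟩, hqt, fun q' hq' => ?_⟩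
      obtain ⟨z, rfl⟩ := hfs q'
      exact hS.ge (sUnion_subset_sUnion htS (hq' rfl))
  exact hbasis.secondCountableTopology
    ((countable_ofPred_finite_subset (countable_countableBasis Z)).image _)

end ClosedMap

theorem isClosedMap_connectedComponents_mk {Z : Type*} [TopologicalSpace Z]
    (h : ∀ (a : Z) (U : Set Z), IsOpen U → connectedComponent a ⊆ U →
      ∀ᶠ b in 𝓝 a, connectedComponent b ⊆ U) :
    IsClosedMap (ConnectedComponents.mk : Z → ConnectedComponents Z) := by
  refine isClosedMap_iff_kernImage.2 fun {U} hU =>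
    ConnectedComponents.isQuotientMap_coe.isOpen_preimage.1 (isOpen_iff_mem_nhds.2 fun a ha => ?_)
  have hmem (b : Z) : ConnectedComponents.mk b ∈ kernImage ConnectedComponents.mk U ↔
      connectedComponent b ⊆ U := by
    rw [← singleton_subset_iff, subset_kernImage_iff, connectedComponents_preimage_singleton]
  filter_upwards [h a U hU ((hmem a).1 ha)] with b hb using (hmem b).2 hb

theorem isPreconnected_preimage_of_isInducing {Z Y : Type*} [TopologicalSpace Z]
    [TopologicalSpace Y] {f : Z → Y} (hf : IsInducing f) {s : Set Y} (hs : IsPreconnected s)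
    (hsf : s ⊆ range f) : IsPreconnected (f ⁻¹' s) := by
  rwa [← hf.isPreconnected_image, image_preimage_eq_of_subset hsf]

theorem image_connectedComponent_of_isInducing {Z Y : Type*} [TopologicalSpace Z]
    [TopologicalSpace Y] {f : Z → Y} (hf : IsInducing f) (z : Z) :
    f '' connectedComponent z = connectedComponentIn (range f) (f z) := by
  have hsub := connectedComponentIn_subset (range f) (f z)
  refine Subset.antisymm ?_ ?_
  · exact (isPreconnected_connectedComponent.image f hf.continuous.continuousOn
      ).subset_connectedComponentIn ⟨z, mem_connectedComponent, rfl⟩ (image_subset_range _ _)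
  · rw [← image_preimage_eq_of_subset hsub]
    exact image_mono ((isPreconnected_preimage_of_isInducing hf isPreconnected_connectedComponentIn
      hsub).subset_connectedComponent (mem_connectedComponentIn (mem_range_self z)))

theorem IsThin.metrizableSpace_and_isZeroDimensional {Z Y : Type*} [TopologicalSpace Z]
    [SigmaCompactSpace Z] [TopologicalSpace Y] [CompactSpace Y] [MetrizableSpace Y] {f : Z → Y}
    (hf : IsEmbedding f) (h : IsThin (range f)) :
    MetrizableSpace (ConnectedComponents Z) ∧ IsZeroDimensional (ConnectedComponents Z) := by
  have : MetrizableSpace Z := hf.metrizableSpace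
  have : SecondCountableTopology Z := hf.secondCountableTopology
  have hclosed : IsClosedMap (ConnectedComponents.mk : Z → ConnectedComponents Z) := by
    refine isClosedMap_connectedComponents_mk fun a U hU haU => ?_
    obtain ⟨V, hV, rfl⟩ := hf.isInducing.isOpen_iff.1 hU
    simp only [← image_subset_iff, image_connectedComponent_of_isInducing hf.isInducing] at haU ⊢
    have hev := h.eventually_connectedComponentIn_subset (mem_range_self a) hV haU
    rwa [← hf.map_nhds_eq, eventually_map] at hev
  have hfibre (q : ConnectedComponents Z) : IsCompact (ConnectedComponents.mk ⁻¹' {q}) := by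
    obtain ⟨a, rfl⟩ := ConnectedComponents.surjective_coe q
    rw [connectedComponents_preimage_singleton, hf.isInducing.isCompact_iff,
      image_connectedComponent_of_isInducing hf.isInducing]
    exact (h.isClosed_connectedComponentIn (f a)).isCompact
  have := t4Space_of_isClosedMap ConnectedComponents.continuous_coe hclosed
    ConnectedComponents.surjective_coe
  have := secondCountableTopology_of_isClosedMap ConnectedComponents.continuous_coe hclosed
    ConnectedComponents.surjective_coe hfibre
  have : SigmaCompactSpace (ConnectedComponents Z) := by
    rw [← isSigmaCompact_univ_iff, ← ConnectedComponents.surjective_coe.range_eq]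
    exact isSigmaCompact_range ConnectedComponents.continuous_coe
  exact ⟨metrizableSpace_of_t3_secondCountable _, isZeroDimensional_of_sigmaCompact⟩

/-! ### Indecomposable spaces -/

section Indecomposable

variable {X : Type*} [TopologicalSpace X] {C : Set X}

theorem isPreconnected_compl_of_separation [PreconnectedSpace X] {U V : Set X}
    (hC : IsPreconnected C) (hU : IsOpen U) (hV : IsOpen V) (hUV : Disjoint U V)
    (hCU : Cᶜ = U ∪ V) : IsPreconnected Vᶜ := by
  have hCV : C ⊆ Vᶜ := subset_compl_comm.1 (hCU ▸ subset_union_right)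
  have hside {s t : Set X} (hs : IsClosed s) (ht : IsClosed t) (hst : Vᶜ ⊆ s ∪ t)
      (hd : Disjoint s t) (hCs : C ⊆ s) : Vᶜ ⊆ s ∨ Vᶜ ⊆ t := by
    have heq : Vᶜ ∩ t = U \ s := by
      refine Subset.antisymm (fun x ⟨hxV, hxt⟩ => ?_) fun x ⟨hxU, hxs⟩ => ?_
      · have hxs := disjoint_right.1 hd hxt
        have hxUV : x ∈ U ∪ V := hCU ▸ fun hxC => hxs (hCs hxC)
        exact ⟨hxUV.resolve_right hxV, hxs⟩
      · have hxV := disjoint_left.1 hUV hxU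
        exact ⟨hxV, (hst hxV).resolve_left hxs⟩
    rcases isClopen_iff.1 ⟨hV.isClosed_compl.inter ht, heq ▸ hU.sdiff hs⟩ with h | h
    · exact .inl ((disjoint_iff_inter_eq_empty.2 h).subset_left_of_subset_union hst)
    · exact .inr fun x _ => (h.ge (mem_univ x)).2
  rw [isPreconnected_iff_subset_of_fully_disjoint_closed hV.isClosed_compl]
  intro s t hs ht hst hd
  rcases isPreconnected_iff_subset_of_disjoint_closed.1 hC s t hs ht (hCV.trans hst)
    (by rw [hd.inter_eq, inter_empty]) with h | h
  · exact hside hs ht hst hd h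
  · exact (hside ht hs (union_comm s t ▸ hst) hd.symm h).symm

namespace IsIndecomposableSpace

theorem isPreconnected_compl (h : IsIndecomposableSpace X) (hC : IsClosed C)
    (hCc : IsPreconnected C) : IsPreconnected Cᶜ := by
  obtain ⟨_, hind⟩ := h
  intro u v hu hv huv hnu hnv
  by_contra hcon
  have hU : IsOpen (Cᶜ ∩ u) := hC.isOpen_compl.inter hu
  have hV : IsOpen (Cᶜ ∩ v) := hC.isOpen_compl.inter hv
  have hd : Disjoint (Cᶜ ∩ u) (Cᶜ ∩ v) :=
    disjoint_left.2 fun x hxu hxv => hcon ⟨x, hxu.1, hxu.2, hxv.2⟩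
  have heq : Cᶜ = Cᶜ ∩ u ∪ Cᶜ ∩ v := by
    rw [← inter_union_distrib_left, inter_eq_left.2 huv]
  refine hind ⟨_, _, hV.isClosed_compl, isPreconnected_compl_of_separation hCc hU hV hd heq,
    compl_ne_univ.2 hnv, hU.isClosed_compl, isPreconnected_compl_of_separation hCc hV hU hd.symm
      (union_comm (Cᶜ ∩ u) _ ▸ heq), compl_ne_univ.2 hnu, ?_⟩
  rw [← compl_inter, hd.symm.inter_eq, compl_empty]

theorem interior_eq_empty (h : IsIndecomposableSpace X) (hC : IsClosed C)
    (hCc : IsPreconnected C) (hne : C ≠ univ) : interior C = ∅ := by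
  rw [interior_eq_empty_iff_dense_compl, dense_iff_closure_eq]
  by_contra hcl
  refine h.2 ⟨C, _, hC, hCc, hne, isClosed_closure,
    (h.isPreconnected_compl hC hCc).closure, hcl, ?_⟩
  exact eq_univ_of_subset (union_subset_union_right C subset_closure) (union_compl_self C)

theorem isNowhereDense_image {Y : Type*} [TopologicalSpace Y] {X : Set Y}
    (h : IsIndecomposableSpace X) {C : Set X} (hC : IsPreconnected C) (hne : closure C ≠ univ) :
    IsNowhereDense (Subtype.val '' C : Set Y) :=
  IsNowhereDense.image_val (h.interior_eq_empty isClosed_closure hC.closure hne)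

end IsIndecomposableSpace

end Indecomposable

/-! ### Meager composants -/

theorem exists_countable_cover_of_forall_mem_proper {X : Type*} [TopologicalSpace X]
    [SecondCountableTopology X] {x : X}
    (h : ∀ y, ∃ K, IsClosed K ∧ IsPreconnected K ∧ K ≠ univ ∧ x ∈ K ∧ y ∈ K) :
    ∃ 𝒮 : Set (Set X), 𝒮.Countable ∧ (∀ C ∈ 𝒮, IsClosed C ∧ IsPreconnected C ∧ C ≠ univ) ∧
      ⋃₀ 𝒮 = univ := by
  refine ⟨(fun U : Set X => connectedComponentIn Uᶜ x) '' countableBasis X,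
    (countable_countableBasis X).image _, ?_, eq_univ_of_forall fun y => ?_⟩
  · rintro _ ⟨U, hU, rfl⟩
    obtain ⟨u, hu⟩ := nonempty_of_mem_countableBasis hU
    exact ⟨isClosed_connectedComponentIn (isOpen_of_mem_countableBasis hU).isClosed_compl x,
      isPreconnected_connectedComponentIn,
      fun heq => connectedComponentIn_subset Uᶜ x (heq.ge (mem_univ u)) hu⟩
  · obtain ⟨K, hK, hKc, hne, hxK, hyK⟩ := h y
    obtain ⟨z, hz⟩ := nonempty_compl.2 hne
    obtain ⟨U, hU, -, hUK⟩ :=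
      (isBasis_countableBasis X).exists_subset_of_mem_open hz hK.isOpen_compl
    exact ⟨_, ⟨U, hU, rfl⟩, hKc.subset_connectedComponentIn hxK (subset_compl_comm.1 hUK) hyK⟩

theorem closure_image_val_inter_subset {Y : Type*} [TopologicalSpace Y] {X : Set Y} {C : Set X}
    (hC : IsClosed C) : closure (Subtype.val '' C : Set Y) ∩ X ⊆ Subtype.val '' C := by
  rintro y ⟨hy, hyX⟩
  refine ⟨⟨y, hyX⟩, ?_, rfl⟩
  rwa [← hC.closure_eq, IsInducing.subtypeVal.closure_eq_preimage_closure_image]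

theorem isZeroDimensional_of_discreteTopology {Q : Type*} [TopologicalSpace Q]
    [DiscreteTopology Q] : IsZeroDimensional Q :=
  isTopologicalBasis_of_isOpen_of_nhds (fun _ hs => hs.isOpen) fun _ U hy _ =>
    ⟨U, isClopen_discrete U, hy, Subset.rfl⟩

namespace IsMeagerComposant

variable {Y : Type*} [TopologicalSpace Y] {X : Set Y}

theorem subset (hX : IsMeagerComposant X) {P : Set Y} (hP : IsCompact P)
    (hPc : IsConnected P) (hnd : IsNowhereDense P) (hne : (P ∩ X).Nonempty) : P ⊆ X := by
  obtain ⟨x, rfl⟩ := hX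
  obtain ⟨y, hyP, K, ⟨hK, hKc, hKn, hxK⟩, hyK⟩ := hne
  exact subset_union_left.trans (subset_sUnion_of_mem ⟨hP.union hK,
    IsConnected.union ⟨y, hyP, hyK⟩ hPc hKc, isNowhereDense_union hnd hKn, .inr hxK⟩)

theorem isCompact_of_isPreconnected [CompactSpace Y] (hX : IsMeagerComposant X)
    (hind : IsIndecomposableSpace X) {C : Set X} (hC : IsClosed C) (hCc : IsPreconnected C)
    (hne : C ≠ univ) : IsCompact C := by
  rcases C.eq_empty_or_nonempty with rfl | hCne
  · exact isCompact_empty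
  have hnd := hind.isNowhereDense_image hCc (by rwa [hC.closure_eq])
  have hconn : IsConnected (Subtype.val '' C : Set Y) :=
    ⟨hCne.image _, hCc.image _ continuous_subtype_val.continuousOn⟩
  have hsub := hX.subset isClosed_closure.isCompact hconn.closure hnd.closure
    (hconn.nonempty.mono (subset_inter subset_closure (Subtype.coe_image_subset X C)))
  rw [Subtype.isCompact_iff]
  exact (isClosed_of_closure_subset ((subset_inter Subset.rfl hsub).trans
    (closure_image_val_inter_subset hC))).isCompact

theorem exists_forall_mem_proper [T2Space Y] (hX : IsMeagerComposant X)
    (hnc : ¬ CompactSpace X) :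
    ∃ x : X, ∀ y, ∃ K, IsClosed K ∧ IsPreconnected K ∧ K ≠ univ ∧ x ∈ K ∧ y ∈ K := by
  have ⟨x, hx⟩ := hX
  have hxX : x ∈ X := by
    have : Nonempty X := not_isEmpty_iff.1 fun _ => hnc inferInstance
    obtain ⟨y, hy⟩ := this
    obtain ⟨K, hK, -⟩ := hx.le hy
    exact hx.ge ⟨K, hK, hK.2.2.2⟩
  refine ⟨⟨x, hxX⟩, fun y => ?_⟩
  obtain ⟨K, ⟨hK, hKc, hKn, hxK⟩, hyK⟩ := hx.le y.2
  have hKX : K ⊆ range (Subtype.val : X → Y) := by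
    rw [Subtype.range_coe]
    exact hX.subset hK hKc hKn ⟨y, hyK, y.2⟩
  refine ⟨Subtype.val ⁻¹' K, hK.isClosed.preimage continuous_subtype_val,
    isPreconnected_preimage_of_isInducing .subtypeVal hKc.isPreconnected hKX,
    fun huniv => hnc ?_, hxK, hyK⟩
  rwa [← isCompact_univ_iff, ← huniv, IsInducing.subtypeVal.isCompact_preimage_iff hKX]

theorem exists_countable_cover [T2Space Y] [SecondCountableTopology Y] (hX : IsMeagerComposant X)
    (hnc : ¬ CompactSpace X) :
    ∃ 𝒮 : Set (Set X), 𝒮.Countable ∧ (∀ C ∈ 𝒮, IsClosed C ∧ IsPreconnected C ∧ C ≠ univ) ∧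
      ⋃₀ 𝒮 = univ :=
  let ⟨_, h⟩ := hX.exists_forall_mem_proper hnc
  exists_countable_cover_of_forall_mem_proper h

theorem compactSpace_or_isMeagre_univ [T2Space Y] [SecondCountableTopology Y]
    (hX : IsMeagerComposant X) (hind : IsIndecomposableSpace X) :
    CompactSpace X ∨ IsMeagre (univ : Set X) := by
  rw [or_iff_not_imp_left, isMeagre_iff_countable_union_isNowhereDense]
  intro hnc
  obtain ⟨𝒮, hcount, h𝒮, hcov⟩ := hX.exists_countable_cover hnc
  refine ⟨𝒮, fun C hC => ?_, hcount, hcov.ge⟩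
  obtain ⟨hCcl, hCc, hne⟩ := h𝒮 C hC
  exact hCcl.isNowhereDense_iff.2 (hind.interior_eq_empty hCcl hCc hne)

theorem sigmaCompactSpace [CompactSpace Y] [T2Space Y] [SecondCountableTopology Y]
    (hX : IsMeagerComposant X) (hind : IsIndecomposableSpace X) : SigmaCompactSpace X := by
  by_cases hc : CompactSpace X
  · infer_instance
  · obtain ⟨𝒮, hcount, h𝒮, hcov⟩ := hX.exists_countable_cover hc
    exact .of_countable 𝒮 hcount (fun C hC =>
      let ⟨hCcl, hCc, hne⟩ := h𝒮 C hC
      hX.isCompact_of_isPreconnected hind hCcl hCc hne) hcov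

theorem isThin_image (hX : IsMeagerComposant X) (hind : IsIndecomposableSpace X) {A : Set X}
    (hA : IsClosed A) (hne : A ≠ univ) : IsThin (Subtype.val '' A : Set Y) where
  isNowhereDense S hSA hS := by
    have hSX : S ⊆ range (Subtype.val : X → Y) := hSA.trans (image_subset_range _ A)
    rw [← image_preimage_eq_of_subset hSX]
    refine hind.isNowhereDense_image (isPreconnected_preimage_of_isInducing .subtypeVal hS hSX)
      fun h => hne (eq_univ_of_univ_subset (h ▸ closure_minimal ?_ hA))
    rw [← preimage_image_eq A Subtype.val_injective]
    exact preimage_mono hSA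
  subset P hP hPc hPn hPA hPne :=
    (subset_inter hPA (hX.subset hP hPc hPn (hPne.mono (inter_subset_inter_right _
      (Subtype.coe_image_subset X A))))).trans (closure_image_val_inter_subset hA)

theorem metrizableSpace_and_isZeroDimensional [CompactSpace Y] [MetrizableSpace Y]
    (hX : IsMeagerComposant X) (hind : IsIndecomposableSpace X) {A : Set X} (hA : IsClosed A) :
    MetrizableSpace (ConnectedComponents A) ∧ IsZeroDimensional (ConnectedComponents A) := by
  rcases eq_or_ne A univ with rfl | hne
  · have : ConnectedSpace X := hind.1
    have : PreconnectedSpace (univ : Set X) := Subtype.preconnectedSpace isPreconnected_univ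
    exact ⟨inferInstance, isZeroDimensional_of_discreteTopology⟩
  · have := hX.sigmaCompactSpace hind
    have : SigmaCompactSpace A := hA.isClosedEmbedding_subtypeVal.sigmaCompactSpace
    refine IsThin.metrizableSpace_and_isZeroDimensional
      (f := Subtype.val ∘ Subtype.val) (IsEmbedding.subtypeVal.comp IsEmbedding.subtypeVal) ?_
    rw [range_comp, Subtype.range_coe]
    exact hX.isThin_image hind hA hne

end IsMeagerComposant

theorem proposition2p3_general {Y : Type*} [TopologicalSpace Y] [CompactSpace Y]
    [MetrizableSpace Y] (X : Set Y) (hX : IsMeagerComposant X) (hind : IsIndecomposableSpace X) :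
    (∀ C : Set X, IsClosed C → IsPreconnected C → C ≠ univ → IsCompact C) ∧
    (CompactSpace X ∨ IsMeagre (univ : Set X)) ∧
    (∀ A : Set X, IsClosed A →
      MetrizableSpace (ConnectedComponents A) ∧ IsZeroDimensional (ConnectedComponents A)) :=
  ⟨fun _ => hX.isCompact_of_isPreconnected hind, hX.compactSpace_or_isMeagre_univ hind,
    fun _ => hX.metrizableSpace_and_isZeroDimensional hind⟩

/-- `Y` is a continuum (nondegenerate, connected, compact, metrizable) and `X` one of its meager
composants, regarded as a space with the subspace topology. `ConnectedComponents A` is the set of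
connected components of `A` with the quotient topology. -/
theorem proposition2p3 {Y : Type*} [TopologicalSpace Y] [CompactSpace Y] [ConnectedSpace Y]
    [MetrizableSpace Y] [Nontrivial Y] (X : Set Y) (hX : IsMeagerComposant X)
    (hind : IsIndecomposableSpace X) :
    (∀ C : Set X, IsClosed C → IsPreconnected C → C ≠ univ → IsCompact C) ∧
    (CompactSpace X ∨ IsMeagre (univ : Set X)) ∧
    (∀ A : Set X, IsClosed A →
      MetrizableSpace (ConnectedComponents A) ∧ IsZeroDimensional (ConnectedComponents A)) :=
  proposition2p3_general X hX hind
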